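/- A residuated lattice is an algebra $(L,\cdot,\backslash,/,\vee,\wedge,e)$ such that $(L,\cdot,e)$ is a monoid, $(L,\vee,\wedge)$ is a lattice with order $\le$, and $xy\le z \iff y\le x\backslash z \iff x\le z/y$ for all $x,y,z\in L$. A variety of residuated lattices is a class of residuated lattices closed under homomorphic images, subalgebras and direct products; it is called semilinear if it is generated, as a variety, by its totally ordered members. For $u,x\in L$ put $$\lambda^*_u(x)=((x\backslash u)\backslash u)\wedge e,\qquad \rho^*_u(x)=(u/(u/x))\wedge e .$$ Let $\mathcal V$ be a variety of residuated lattices. Then the following statements are equivalent: (1) $\mathcal V$ is semilinear. (2a) $\mathcal V$ satisfies the equation $\lambda^*_u((x\vee y)\backslash x)\vee\rho^*_v((x\vee y)\backslash y)\approx e$. (2b) $\mathcal V$ satisfies the equation $\lambda^*_u(x/(x\vee y))\vee\rho^*_v(y/(x\vee y))\approx e$. (3a) $\mathcal V$ satisfies the left prelinearity law $((x\backslash y)\wedge e)\vee((y\backslash x)\wedge e)\approx e$ and the quasi-identity $$x\vee y\approx e\ \Rightarrow\ \lambda^*_u(x)\vee\rho^*_v(y)\approx e.$$ (3b) $\mathcal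 V$ satisfies the right prelinearity law $((y/x)\wedge e)\vee((x/y)\wedge e)\approx e$ and the same quasi-identity. -/

import Mathlib

universe u

/-- Residuated lattices `(L, ·, \, /, ∨, ∧, e)`. The unit `e` is written `1`. -/
class ResiduatedLattice (L : Type u) extends Lattice L, Monoid L where
  /-- The left residual `x \ z`. -/
  lres : L → L → L
  /-- The right residual `z / y`. -/
  rres : L → L → L
  mul_le_iff_le_lres : ∀ x y z : L, x * y ≤ z ↔ y ≤ lres x z
  mul_le_iff_le_rres : ∀ x y z : L, x * y ≤ z ↔ x ≤ rres z y

/-- `x ⟍ z` is the left residual of the multiplication (numerator on the right). -/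
infix:70 " ⟍ " => ResiduatedLattice.lres

/-- `z ⟋ y` is the right residual of the multiplication (numerator on the left). -/
infix:70 " ⟋ " => ResiduatedLattice.rres

namespace ResiduatedLattice

/-- Homomorphisms of residuated lattices: maps preserving all six operations. -/
structure IsHom {A B : Type u} [ResiduatedLattice A] [ResiduatedLattice B] (f : A → B) :
    Prop where
  map_one : f 1 = 1
  map_mul : ∀ x y, f (x * y) = f x * f y
  map_lres : ∀ x y, f (x ⟍ y) = f x ⟍ f y
  map_rres : ∀ x y, f (x ⟋ y) = f x ⟋ f y
  map_sup : ∀ x y, f (x ⊔ y) = f x ⊔ f y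
  map_inf : ∀ x y, f (x ⊓ y) = f x ⊓ f y

/-- Direct products, with all operations and the order taken coordinatewise. -/
instance instPi {ι : Type u} (A : ι → Type u) [∀ i, ResiduatedLattice (A i)] :
    ResiduatedLattice (∀ i, A i) where
  lres x z := fun i => x i ⟍ z i
  rres z y := fun i => z i ⟋ y i
  mul_le_iff_le_lres _ _ _ := forall_congr' fun _ => mul_le_iff_le_lres _ _ _
  mul_le_iff_le_rres _ _ _ := forall_congr' fun _ => mul_le_iff_le_rres _ _ _

/-- A variety of residuated lattices: a class of residuated lattices closed under homomorphic
images, (isomorphic copies of) subalgebras, and arbitrary direct products. -/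
structure Variety where
  /-- `V.Mem L` says that the residuated lattice `L` belongs to the class. -/
  Mem : ∀ (L : Type u) [ResiduatedLattice L], Prop
  mem_of_surjective : ∀ (A B : Type u) [ResiduatedLattice A] [ResiduatedLattice B] (f : A → B),
    IsHom f → Function.Surjective f → Mem A → Mem B
  mem_of_injective : ∀ (A B : Type u) [ResiduatedLattice A] [ResiduatedLattice B] (f : A → B),
    IsHom f → Function.Injective f → Mem B → Mem A
  mem_pi : ∀ (ι : Type u) (A : ι → Type u) [∀ i, ResiduatedLattice (A i)],
    (∀ i, Mem (A i)) → Mem (∀ i, A i)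

/-- The lattice order of `L` is total. -/
def IsTotallyOrdered (L : Type u) [ResiduatedLattice L] : Prop :=
  ∀ x y : L, x ≤ y ∨ y ≤ x

/-- A variety is semilinear if it is generated by its totally ordered members, i.e. it is the
least variety that contains all its totally ordered members. -/
def Variety.IsSemilinear (V : Variety.{u}) : Prop :=
  ∀ W : Variety.{u},
    (∀ (L : Type u) [ResiduatedLattice L], V.Mem L → IsTotallyOrdered L → W.Mem L) →
      ∀ (L : Type u) [ResiduatedLattice L], V.Mem L → W.Mem L

/-- The left `*`-conjugation by `u`. -/
def lamStar {L : Type u} [ResiduatedLattice L] (u x : L) : L :=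
  ((x ⟍ u) ⟍ u) ⊓ 1

/-- The right `*`-conjugation by `u`. -/
def rhoStar {L : Type u} [ResiduatedLattice L] (u x : L) : L :=
  (u ⟋ (u ⟋ x)) ⊓ 1

/-- Every member of `V` satisfies the left prelinearity law. -/
def Variety.LeftPrelinear (V : Variety.{u}) : Prop :=
  ∀ (L : Type u) [ResiduatedLattice L], V.Mem L →
    ∀ x y : L, ((x ⟍ y) ⊓ 1) ⊔ ((y ⟍ x) ⊓ 1) = 1

/-- Every member of `V` satisfies the right prelinearity law. -/
def Variety.RightPrelinear (V : Variety.{u}) : Prop :=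
  ∀ (L : Type u) [ResiduatedLattice L], V.Mem L →
    ∀ x y : L, ((y ⟋ x) ⊓ 1) ⊔ ((x ⟋ y) ⊓ 1) = 1

/-- Every member of `V` satisfies `x ∨ y = e ⇒ λ*_u(x) ∨ ρ*_v(y) = e`. -/
def Variety.StarQuasiIdentity (V : Variety.{u}) : Prop :=
  ∀ (L : Type u) [ResiduatedLattice L], V.Mem L →
    ∀ x y u v : L, x ⊔ y = 1 → lamStar u x ⊔ rhoStar v y = 1

end ResiduatedLattice

/-! In a chain, `x ⊔ y` is `x` or `y`, so one of the two residuals in (2a) or (2b) is above `1` and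
its conjugate is `1`. The equation then passes to the variety generated by the chains. Conversely,
conjugating an element by itself gives something below it (`lamStar_self_le`), which yields
prelinearity; the case `x ⊔ y = 1` of the equation is the quasi-identity.

The return to semilinearity embeds an algebra into a product of chains. Given `¬ a ≤ b`, divide by a
normal filter maximal among those omitting `(a ⟍ b) ⊓ 1`. The quasi-identity makes polars normal
filters (`isNormalFilter_polar`). A polar and its double polar meet only in `1`, so by maximality
one of them is trivial, and `1` is join-prime in the quotient (`eq_one_or_eq_one_of_sup_eq_one`).
Either prelinearity law then makes the quotient a chain. -/

namespace ResiduatedLattice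

/-! ### Residuation and starred conjugates -/

section Arithmetic

variable {L : Type u} [ResiduatedLattice L] {x y z u v : L}

theorem le_lres_iff : y ≤ x ⟍ z ↔ x * y ≤ z := (mul_le_iff_le_lres x y z).symm

theorem le_rres_iff : x ≤ z ⟋ y ↔ x * y ≤ z := (mul_le_iff_le_rres x y z).symm

theorem mul_lres_le : x * (x ⟍ z) ≤ z := le_lres_iff.1 le_rfl

theorem rres_mul_le : (z ⟋ y) * y ≤ z := le_rres_iff.1 le_rfl

theorem mul_le_mul_of_le_left (h : x ≤ y) (z : L) : z * x ≤ z * y :=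
  le_lres_iff.1 (h.trans (le_lres_iff.2 le_rfl))

theorem mul_le_mul_of_le_right (h : x ≤ y) (z : L) : x * z ≤ y * z :=
  le_rres_iff.1 (h.trans (le_rres_iff.2 le_rfl))

theorem mul_le_of_right_le_one (h : y ≤ 1) : x * y ≤ x := by
  simpa using mul_le_mul_of_le_left h x

theorem mul_le_of_left_le_one (h : y ≤ 1) : y * x ≤ x := by
  simpa using mul_le_mul_of_le_right h x

theorem sup_mul_le (hx : x * u ≤ z) (hy : y * u ≤ z) : (x ⊔ y) * u ≤ z :=
  le_rres_iff.1 (sup_le (le_rres_iff.2 hx) (le_rres_iff.2 hy))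

theorem mul_sup_le (hx : u * x ≤ z) (hy : u * y ≤ z) : u * (x ⊔ y) ≤ z :=
  le_lres_iff.1 (sup_le (le_lres_iff.2 hx) (le_lres_iff.2 hy))

theorem lres_anti_left (h : x ≤ y) (z : L) : y ⟍ z ≤ x ⟍ z :=
  le_lres_iff.2 ((mul_le_mul_of_le_right h _).trans mul_lres_le)

theorem rres_anti_right (h : x ≤ y) (z : L) : z ⟋ y ≤ z ⟋ x :=
  le_rres_iff.2 ((mul_le_mul_of_le_left h _).trans rres_mul_le)

theorem one_lres (x : L) : (1 : L) ⟍ x = x :=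
  le_antisymm (by simpa using mul_lres_le (x := 1) (z := x)) (le_lres_iff.2 (by simp))

theorem rres_one (x : L) : x ⟋ (1 : L) = x :=
  le_antisymm (by simpa using rres_mul_le (y := 1) (z := x)) (le_rres_iff.2 (by simp))

theorem one_le_lres_iff : 1 ≤ x ⟍ y ↔ x ≤ y := by simp [le_lres_iff]

theorem one_le_rres_iff : 1 ≤ y ⟋ x ↔ x ≤ y := by simp [le_rres_iff]

theorem lamStar_le_one (u x : L) : lamStar u x ≤ 1 := inf_le_right

theorem rhoStar_le_one (u x : L) : rhoStar u x ≤ 1 := inf_le_right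

theorem lamStar_eq_one (h : 1 ≤ x) (u : L) : lamStar u x = 1 :=
  inf_eq_right.2 (one_le_lres_iff.2 (by simpa [one_lres] using lres_anti_left h u))

theorem rhoStar_eq_one (h : 1 ≤ x) (u : L) : rhoStar u x = 1 :=
  inf_eq_right.2 (one_le_rres_iff.2 (by simpa [rres_one] using rres_anti_right h u))

theorem lamStar_self_le (x : L) : lamStar x x ≤ x :=
  inf_le_left.trans
    (by simpa [one_lres] using lres_anti_left (one_le_lres_iff.2 (le_refl x)) x)

theorem rhoStar_self_le (x : L) : rhoStar x x ≤ x :=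
  inf_le_left.trans
    (by simpa [rres_one] using rres_anti_right (one_le_rres_iff.2 (le_refl x)) x)

/-- Since `u ≤ x ⟍ (x * u)`, a suitable starred conjugate bounds the ordinary one from below.
Control of starred conjugates thus gives closure under ordinary conjugation. -/
theorem lamStar_mul_le (u x : L) : lamStar (x * u) x ≤ (u ⟍ (x * u)) ⊓ 1 :=
  inf_le_inf_right _ (lres_anti_left (le_lres_iff.2 le_rfl) _)

theorem rhoStar_mul_le (u x : L) : rhoStar (u * x) x ≤ ((u * x) ⟋ u) ⊓ 1 :=
  inf_le_inf_right _ (rres_anti_right (le_rres_iff.2 le_rfl) _)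

end Arithmetic

/-! ### Normal filters and their quotients -/

/-- The normal filters of the negative cone: they are closed under multiplication and under the
conjugations by all elements. -/
structure IsNormalFilter {L : Type u} [ResiduatedLattice L] (F : Set L) : Prop where
  le_one : ∀ {x}, x ∈ F → x ≤ 1
  one_mem : 1 ∈ F
  mul_mem : ∀ {x y}, x ∈ F → y ∈ F → x * y ∈ F
  mem_of_le : ∀ {x y}, x ∈ F → x ≤ y → y ≤ 1 → y ∈ F
  conj_left_mem : ∀ {x} (u : L), x ∈ F → (u ⟍ (x * u)) ⊓ 1 ∈ F
  conj_right_mem : ∀ {x} (u : L), x ∈ F → ((u * x) ⟋ u) ⊓ 1 ∈ F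

namespace IsNormalFilter

variable {L : Type u} [ResiduatedLattice L] {F : Set L} {x y z u v : L}

/-- The preorder of the quotient by a normal filter. -/
def le (_ : IsNormalFilter F) (x y : L) : Prop := ∃ f ∈ F, x * f ≤ y

variable (hF : IsNormalFilter F)

theorem le_of_le (h : x ≤ y) : hF.le x y := ⟨1, hF.one_mem, by simpa using h⟩

theorem le_trans (h : hF.le x y) (h₂ : hF.le y z) : hF.le x z := by
  obtain ⟨f, hf, h⟩ := h
  obtain ⟨g, hg, h₂⟩ := h₂
  refine ⟨f * g, hF.mul_mem hf hg, ?_⟩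
  rw [← mul_assoc]
  exact (mul_le_mul_of_le_right h g).trans h₂

/-- Conjugation by `x` carries a filter factor from one side of `x` to the other. This is where the
construction of the quotient needs normality. -/
theorem le_iff_mul_left : hF.le x y ↔ ∃ f ∈ F, f * x ≤ y := by
  constructor
  · rintro ⟨f, hf, h⟩
    exact ⟨_, hF.conj_right_mem x hf, (le_rres_iff.1 inf_le_left).trans h⟩
  · rintro ⟨f, hf, h⟩
    exact ⟨_, hF.conj_left_mem x hf, (le_lres_iff.1 inf_le_left).trans h⟩

theorem mul_le_iff_le_lres : hF.le (x * y) z ↔ hF.le y (x ⟍ z) := by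
  simp only [le, le_lres_iff, mul_assoc]

theorem mul_le_iff_le_rres : hF.le (x * y) z ↔ hF.le x (z ⟋ y) := by
  simp only [le_iff_mul_left, le_rres_iff, mul_assoc]

theorem mul_le_mul (h : hF.le x y) (h₂ : hF.le u v) : hF.le (x * u) (y * v) :=
  hF.le_trans
    (hF.mul_le_iff_le_rres.2 (hF.le_trans h (hF.le_of_le (le_rres_iff.2 le_rfl))))
    (hF.mul_le_iff_le_lres.2 (hF.le_trans h₂ (hF.le_of_le (le_lres_iff.2 le_rfl))))

theorem lres_le_lres (h : hF.le x y) (h₂ : hF.le u v) : hF.le (y ⟍ u) (x ⟍ v) :=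
  hF.mul_le_iff_le_lres.1 <|
    hF.le_trans (hF.mul_le_mul h (hF.le_of_le le_rfl)) <|
      hF.le_trans (hF.le_of_le mul_lres_le) h₂

theorem rres_le_rres (h : hF.le x y) (h₂ : hF.le u v) : hF.le (u ⟋ y) (v ⟋ x) :=
  hF.mul_le_iff_le_rres.1 <|
    hF.le_trans (hF.mul_le_mul (hF.le_of_le le_rfl) h) <|
      hF.le_trans (hF.le_of_le rres_mul_le) h₂

theorem sup_le (h : hF.le x z) (h₂ : hF.le y z) : hF.le (x ⊔ y) z := by
  obtain ⟨f, hf, h⟩ := h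
  obtain ⟨g, hg, h₂⟩ := h₂
  exact ⟨f * g, hF.mul_mem hf hg, sup_mul_le
    ((mul_le_mul_of_le_left (mul_le_of_right_le_one (hF.le_one hg)) x).trans h)
    ((mul_le_mul_of_le_left (mul_le_of_left_le_one (hF.le_one hf)) y).trans h₂)⟩

theorem le_inf (h : hF.le x y) (h₂ : hF.le x z) : hF.le x (y ⊓ z) := by
  obtain ⟨f, hf, h⟩ := h
  obtain ⟨g, hg, h₂⟩ := h₂
  exact ⟨f * g, hF.mul_mem hf hg, _root_.le_inf
    ((mul_le_mul_of_le_left (mul_le_of_right_le_one (hF.le_one hg)) x).trans h)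
    ((mul_le_mul_of_le_left (mul_le_of_left_le_one (hF.le_one hf)) x).trans h₂)⟩

/-- Two elements are congruent modulo a normal filter if each is below the other. -/
def setoid : Setoid L where
  r x y := hF.le x y ∧ hF.le y x
  iseqv :=
    ⟨fun _ => ⟨hF.le_of_le le_rfl, hF.le_of_le le_rfl⟩, And.symm,
      fun h h₂ => ⟨hF.le_trans h.1 h₂.1, hF.le_trans h₂.2 h.2⟩⟩

/-- The quotient of a residuated lattice by a normal filter. -/
def Quot : Type u := Quotient hF.setoid

/-- The class of an element in the quotient. -/
def toQuot (x : L) : hF.Quot := Quotient.mk hF.setoid x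

theorem toQuot_surjective : Function.Surjective hF.toQuot := Quotient.exists_rep

instance : LE hF.Quot where
  le := Quotient.lift₂ hF.le fun _ _ _ _ h h₂ => propext
    ⟨fun k => hF.le_trans h.2 (hF.le_trans k h₂.1),
      fun k => hF.le_trans h.1 (hF.le_trans k h₂.2)⟩

theorem toQuot_le_toQuot : hF.toQuot x ≤ hF.toQuot y ↔ hF.le x y := Iff.rfl

instance : ResiduatedLattice hF.Quot where
  le_refl := by
    rintro ⟨x⟩
    exact hF.le_of_le le_rfl
  le_trans := by
    rintro ⟨x⟩ ⟨y⟩ ⟨z⟩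
    exact hF.le_trans
  le_antisymm := by
    rintro ⟨x⟩ ⟨y⟩ h h₂
    exact Quotient.sound ⟨h, h₂⟩
  sup := Quotient.map₂ (· ⊔ ·) fun _ _ h _ _ h₂ =>
    ⟨hF.sup_le (hF.le_trans h.1 (hF.le_of_le le_sup_left))
        (hF.le_trans h₂.1 (hF.le_of_le le_sup_right)),
      hF.sup_le (hF.le_trans h.2 (hF.le_of_le le_sup_left))
        (hF.le_trans h₂.2 (hF.le_of_le le_sup_right))⟩
  le_sup_left := by
    rintro ⟨x⟩ ⟨y⟩
    exact hF.le_of_le le_sup_left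
  le_sup_right := by
    rintro ⟨x⟩ ⟨y⟩
    exact hF.le_of_le le_sup_right
  sup_le := by
    rintro ⟨x⟩ ⟨y⟩ ⟨z⟩
    exact hF.sup_le
  inf := Quotient.map₂ (· ⊓ ·) fun _ _ h _ _ h₂ =>
    ⟨hF.le_inf (hF.le_trans (hF.le_of_le inf_le_left) h.1)
        (hF.le_trans (hF.le_of_le inf_le_right) h₂.1),
      hF.le_inf (hF.le_trans (hF.le_of_le inf_le_left) h.2)
        (hF.le_trans (hF.le_of_le inf_le_right) h₂.2)⟩
  inf_le_left := by
    rintro ⟨x⟩ ⟨y⟩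
    exact hF.le_of_le inf_le_left
  inf_le_right := by
    rintro ⟨x⟩ ⟨y⟩
    exact hF.le_of_le inf_le_right
  le_inf := by
    rintro ⟨x⟩ ⟨y⟩ ⟨z⟩
    exact hF.le_inf
  one := hF.toQuot 1
  mul := Quotient.map₂ (· * ·) fun _ _ h _ _ h₂ =>
    ⟨hF.mul_le_mul h.1 h₂.1, hF.mul_le_mul h.2 h₂.2⟩
  mul_assoc := by
    rintro ⟨x⟩ ⟨y⟩ ⟨z⟩
    exact congrArg hF.toQuot (mul_assoc x y z)
  one_mul := by
    rintro ⟨x⟩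
    exact congrArg hF.toQuot (one_mul x)
  mul_one := by
    rintro ⟨x⟩
    exact congrArg hF.toQuot (mul_one x)
  lres := Quotient.map₂ (· ⟍ ·) fun _ _ h _ _ h₂ =>
    ⟨hF.lres_le_lres h.2 h₂.1, hF.lres_le_lres h.1 h₂.2⟩
  rres := Quotient.map₂ (· ⟋ ·) fun _ _ h _ _ h₂ =>
    ⟨hF.rres_le_rres h₂.2 h.1, hF.rres_le_rres h₂.1 h.2⟩
  mul_le_iff_le_lres := by
    rintro ⟨x⟩ ⟨y⟩ ⟨z⟩
    exact hF.mul_le_iff_le_lres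
  mul_le_iff_le_rres := by
    rintro ⟨x⟩ ⟨y⟩ ⟨z⟩
    exact hF.mul_le_iff_le_rres

theorem isHom_toQuot : IsHom hF.toQuot where
  map_one := rfl
  map_mul _ _ := rfl
  map_lres _ _ := rfl
  map_rres _ _ := rfl
  map_sup _ _ := rfl
  map_inf _ _ := rfl

theorem toQuot_eq_one (hx : x ∈ F) : hF.toQuot x = 1 :=
  le_antisymm (hF.toQuot_le_toQuot.2 (hF.le_of_le (hF.le_one hx)))
    (hF.toQuot_le_toQuot.2 ⟨x, hx, by simp⟩)

theorem mem_of_toQuot_eq_one (h : hF.toQuot x = 1) (hx : x ≤ 1) : x ∈ F := by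
  obtain ⟨f, hf, hfx⟩ := hF.toQuot_le_toQuot.1 h.ge
  exact hF.mem_of_le hf (by simpa using hfx) hx

theorem le_iff_mem : hF.le x y ↔ (x ⟍ y) ⊓ 1 ∈ F := by
  constructor
  · rintro ⟨f, hf, h⟩
    exact hF.mem_of_le hf (_root_.le_inf (le_lres_iff.2 h) (hF.le_one hf)) inf_le_right
  · exact fun h => ⟨_, h, le_lres_iff.1 inf_le_left⟩

/-- The negative elements whose class lies in a normal filter of the quotient. -/
theorem preimage {G : Set hF.Quot} (hG : IsNormalFilter G) :
    IsNormalFilter {x | x ≤ 1 ∧ hF.toQuot x ∈ G} where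
  le_one h := h.1
  one_mem := ⟨le_rfl, hG.one_mem⟩
  mul_mem h h₂ := ⟨(mul_le_of_right_le_one h₂.1).trans h.1, hG.mul_mem h.2 h₂.2⟩
  mem_of_le h h₂ h₃ :=
    ⟨h₃, hG.mem_of_le h.2 (hF.toQuot_le_toQuot.2 (hF.le_of_le h₂)) (hF.toQuot_le_toQuot.2 (hF.le_of_le h₃))⟩
  conj_left_mem u h := ⟨inf_le_right, hG.conj_left_mem (hF.toQuot u) h.2⟩
  conj_right_mem u h := ⟨inf_le_right, hG.conj_right_mem (hF.toQuot u) h.2⟩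

end IsNormalFilter

theorem isNormalFilter_singleton_one (L : Type u) [ResiduatedLattice L] :
    IsNormalFilter ({1} : Set L) where
  le_one h := le_of_eq h
  one_mem := rfl
  mul_mem := by
    rintro _ _ rfl rfl
    exact mul_one 1
  mem_of_le := by
    rintro _ y rfl h h₂
    exact le_antisymm h₂ h
  conj_left_mem := by
    rintro _ u rfl
    exact inf_eq_right.2 (one_le_lres_iff.2 (by simp))
  conj_right_mem := by
    rintro _ u rfl
    exact inf_eq_right.2 (one_le_rres_iff.2 (by simp))

theorem isNormalFilter_sUnion {L : Type u} [ResiduatedLattice L] {C : Set (Set L)}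
    (hC : ∀ F ∈ C, IsNormalFilter F) (hchain : IsChain (· ⊆ ·) C) (hne : C.Nonempty) :
    IsNormalFilter (⋃₀ C) where
  le_one := by
    rintro x ⟨F, hF, hx⟩
    exact (hC F hF).le_one hx
  one_mem := by
    obtain ⟨F, hF⟩ := hne
    exact ⟨F, hF, (hC F hF).one_mem⟩
  mul_mem := by
    rintro x y ⟨F, hF, hx⟩ ⟨G, hG, hy⟩
    rcases hchain.total hF hG with h | h
    · exact ⟨G, hG, (hC G hG).mul_mem (h hx) hy⟩
    · exact ⟨F, hF, (hC F hF).mul_mem hx (h hy)⟩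
  mem_of_le := by
    rintro x y ⟨F, hF, hx⟩ h h₂
    exact ⟨F, hF, (hC F hF).mem_of_le hx h h₂⟩
  conj_left_mem := by
    rintro x u ⟨F, hF, hx⟩
    exact ⟨F, hF, (hC F hF).conj_left_mem u hx⟩
  conj_right_mem := by
    rintro x u ⟨F, hF, hx⟩
    exact ⟨F, hF, (hC F hF).conj_right_mem u hx⟩

theorem exists_maximal_isNormalFilter_notMem {L : Type u} [ResiduatedLattice L] {c : L}
    (hc : c ≠ 1) : ∃ F, Maximal (fun F : Set L => IsNormalFilter F ∧ c ∉ F) F := by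
  obtain ⟨F, -, hF⟩ := zorn_subset_nonempty {F : Set L | IsNormalFilter F ∧ c ∉ F}
    (fun C hC hchain hne => ⟨⋃₀ C,
      ⟨isNormalFilter_sUnion (fun F hF => (hC hF).1) hchain hne, by
        rintro ⟨F, hF, hcF⟩
        exact (hC hF).2 hcF⟩, fun F hF => Set.subset_sUnion_of_mem hF⟩)
    {1} ⟨isNormalFilter_singleton_one L, hc⟩
  exact ⟨F, hF⟩

/-! ### Polars and join-primeness of the unit -/

/-- The elements of the negative cone orthogonal to every element of `S`. -/
def polar {L : Type u} [ResiduatedLattice L] (S : Set L) : Set L :=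
  {x | x ≤ 1 ∧ ∀ y ∈ S, x ⊔ y = 1}

theorem isNormalFilter_polar {L : Type u} [ResiduatedLattice L]
    (hL : ∀ x y u v : L, x ⊔ y = 1 → lamStar u x ⊔ rhoStar v y = 1) {S : Set L}
    (hS : ∀ y ∈ S, y ≤ 1) : IsNormalFilter (polar S) where
  le_one h := h.1
  one_mem := ⟨le_rfl, fun y hy => sup_eq_left.2 (hS y hy)⟩
  mul_mem := by
    rintro x z ⟨hx, hxS⟩ ⟨hz, hzS⟩
    refine ⟨(mul_le_of_right_le_one hz).trans hx, fun y hy => le_antisymm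
      (sup_le ((mul_le_of_right_le_one hz).trans hx) (hS y hy)) ?_⟩
    calc (1 : L) = (x ⊔ y) * (z ⊔ y) := by rw [hxS y hy, hzS y hy, one_mul]
      _ ≤ x * z ⊔ y := sup_mul_le
        (mul_sup_le le_sup_left ((mul_le_of_left_le_one hx).trans le_sup_right))
        ((mul_le_of_right_le_one (hzS y hy).le).trans le_sup_right)
  mem_of_le := by
    rintro x z ⟨-, hxS⟩ hxz hz
    exact ⟨hz, fun y hy => le_antisymm (sup_le hz (hS y hy))
      ((hxS y hy).ge.trans (sup_le_sup_right hxz y))⟩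
  conj_left_mem := by
    rintro x u ⟨-, hxS⟩
    refine ⟨inf_le_right, fun y hy => le_antisymm (sup_le inf_le_right (hS y hy)) ?_⟩
    -- Conjugating `y` by itself removes the star on that side, leaving only the conjugate of `x`.
    exact (hL x y (x * u) y (hxS y hy)).ge.trans
      (sup_le_sup (lamStar_mul_le u x) (rhoStar_self_le y))
  conj_right_mem := by
    rintro x u ⟨-, hxS⟩
    refine ⟨inf_le_right, fun y hy => le_antisymm (sup_le inf_le_right (hS y hy)) ?_⟩
    rw [sup_comm]
    exact (hL y x y (u * x) (sup_comm x y ▸ hxS y hy)).ge.trans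
      (sup_le_sup (lamStar_self_le y) (rhoStar_mul_le u x))

section Prime

variable {L : Type u} [ResiduatedLattice L] {F : Set L} {c : L}

/-- The preimage of `G` is a normal filter that contains `F` and omits `c`, so by maximality it is
`F`. -/
theorem eq_one_of_mem_of_maximal (hF : IsNormalFilter F)
    (hmax : Maximal (fun F : Set L => IsNormalFilter F ∧ c ∉ F) F) {G : Set hF.Quot}
    (hG : IsNormalFilter G) (hc : hF.toQuot c ∉ G) {a : hF.Quot} (ha : a ∈ G) : a = 1 := by
  obtain ⟨x, rfl⟩ := hF.toQuot_surjective a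
  -- The representative `x` need not be negative, but `x ⊓ 1` is and has the same class.
  have hx : hF.toQuot (x ⊓ 1) = hF.toQuot x := inf_eq_left.2 (hG.le_one ha)
  have hsub := hmax.2 ⟨hF.preimage hG, fun h => hc h.2⟩ fun y hy =>
    ⟨hF.le_one hy, (hF.toQuot_eq_one hy).symm ▸ hG.one_mem⟩
  rw [← hx]
  exact hF.toQuot_eq_one (hsub ⟨inf_le_right, hx.symm ▸ ha⟩)

theorem eq_one_or_eq_one_of_sup_eq_one (hF : IsNormalFilter F)
    (hmax : Maximal (fun F : Set L => IsNormalFilter F ∧ c ∉ F) F) (hc : c ≤ 1)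
    (hQ : ∀ x y u v : hF.Quot, x ⊔ y = 1 → lamStar u x ⊔ rhoStar v y = 1) {a b : hF.Quot}
    (hab : a ⊔ b = 1) : a = 1 ∨ b = 1 := by
  have ha : a ∈ polar {b} := ⟨hab ▸ le_sup_left, fun y hy => hy ▸ hab⟩
  have hb : b ∈ polar (polar {b}) :=
    ⟨hab ▸ le_sup_right, fun y hy => sup_comm y b ▸ hy.2 b rfl⟩
  have hG : IsNormalFilter (polar {b}) := isNormalFilter_polar hQ fun y hy => hy ▸ hb.1
  have hH : IsNormalFilter (polar (polar {b})) := isNormalFilter_polar hQ fun y hy => hy.1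
  by_cases hcG : hF.toQuot c ∈ polar {b}
  · refine .inr (eq_one_of_mem_of_maximal hF hmax hH (fun hcH => hmax.1.2 ?_) hb)
    -- An element of both polars is orthogonal to itself, hence equal to `1`.
    exact hF.mem_of_toQuot_eq_one (sup_idem (hF.toQuot c) ▸ hcH.2 _ hcG) hc
  · exact .inl (eq_one_of_mem_of_maximal hF hmax hG hcG ha)

end Prime

/-! ### Homomorphisms and equational classes -/

/-- The evaluation maps of a product are homomorphisms. -/
theorem isHom_eval {ι : Type u} (A : ι → Type u) [∀ i, ResiduatedLattice (A i)] (i : ι) :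
    IsHom fun f : ∀ i, A i => f i where
  map_one := rfl
  map_mul _ _ := rfl
  map_lres _ _ := rfl
  map_rres _ _ := rfl
  map_sup _ _ := rfl
  map_inf _ _ := rfl

theorem IsHom.pi {ι L : Type u} {A : ι → Type u} [ResiduatedLattice L]
    [∀ i, ResiduatedLattice (A i)] {f : ∀ i, L → A i} (hf : ∀ i, IsHom (f i)) :
    IsHom fun x i => f i x where
  map_one := funext fun i => (hf i).map_one
  map_mul x y := funext fun i => (hf i).map_mul x y
  map_lres x y := funext fun i => (hf i).map_lres x y
  map_rres x y := funext fun i => (hf i).map_rres x y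
  map_sup x y := funext fun i => (hf i).map_sup x y
  map_inf x y := funext fun i => (hf i).map_inf x y

section Hom

variable {A B : Type u} [ResiduatedLattice A] [ResiduatedLattice B] {f : A → B}

theorem IsHom.map_lamStar (hf : IsHom f) (u x : A) :
    f (lamStar u x) = lamStar (f u) (f x) := by
  simp only [lamStar, hf.map_inf, hf.map_lres, hf.map_one]

theorem IsHom.map_rhoStar (hf : IsHom f) (u x : A) :
    f (rhoStar u x) = rhoStar (f u) (f x) := by
  simp only [rhoStar, hf.map_inf, hf.map_rres, hf.map_one]

end Hom

/-- The variety defined by the equation `t x y u v = 1`, where `t` is an operation that is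
preserved by all homomorphisms. -/
def Variety.ofEquation (t : ∀ (L : Type u) [ResiduatedLattice L], L → L → L → L → L)
    (ht : ∀ (A B : Type u) [ResiduatedLattice A] [ResiduatedLattice B] (f : A → B), IsHom f →
      ∀ x y u v, f (t A x y u v) = t B (f x) (f y) (f u) (f v)) : Variety.{u} where
  Mem L _ := ∀ x y u v : L, t L x y u v = 1
  mem_of_surjective A B _ _ f hf hsurj hA x y u v := by
    obtain ⟨x, rfl⟩ := hsurj x
    obtain ⟨y, rfl⟩ := hsurj y
    obtain ⟨u, rfl⟩ := hsurj u
    obtain ⟨v, rfl⟩ := hsurj v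
    rw [← ht A B f hf, hA, hf.map_one]
  mem_of_injective A B _ _ f hf hinj hB x y u v :=
    hinj (by rw [ht A B f hf, hB, hf.map_one])
  mem_pi ι A _ hA x y u v := funext fun i => by
    rw [ht _ _ _ (isHom_eval A i), hA]
    rfl

/-! ### The implications -/

namespace Variety

variable {V : Variety.{u}}

theorem IsSemilinear.lres_equation (hV : V.IsSemilinear) (L : Type u) [ResiduatedLattice L]
    (hL : V.Mem L) (x y u v : L) :
    lamStar u ((x ⊔ y) ⟍ x) ⊔ rhoStar v ((x ⊔ y) ⟍ y) = 1 := by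
  refine hV (.ofEquation
    (fun L _ x y u v => lamStar u ((x ⊔ y) ⟍ x) ⊔ rhoStar v ((x ⊔ y) ⟍ y)) ?_) ?_ L hL x y u v
  · intro A B _ _ f hf x y u v
    simp only [hf.map_sup, hf.map_lamStar, hf.map_rhoStar, hf.map_lres]
  · intro L _ _ htot x y u v
    beta_reduce
    rcases htot x y with h | h
    · rw [rhoStar_eq_one (one_le_lres_iff.2 (sup_le h le_rfl))]
      exact sup_eq_right.2 (lamStar_le_one _ _)
    · rw [lamStar_eq_one (one_le_lres_iff.2 (sup_le le_rfl h))]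
      exact sup_eq_left.2 (rhoStar_le_one _ _)

theorem IsSemilinear.rres_equation (hV : V.IsSemilinear) (L : Type u) [ResiduatedLattice L]
    (hL : V.Mem L) (x y u v : L) :
    lamStar u (x ⟋ (x ⊔ y)) ⊔ rhoStar v (y ⟋ (x ⊔ y)) = 1 := by
  refine hV (.ofEquation
    (fun L _ x y u v => lamStar u (x ⟋ (x ⊔ y)) ⊔ rhoStar v (y ⟋ (x ⊔ y))) ?_) ?_ L hL x y u v
  · intro A B _ _ f hf x y u v
    simp only [hf.map_sup, hf.map_lamStar, hf.map_rhoStar, hf.map_rres]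
  · intro L _ _ htot x y u v
    beta_reduce
    rcases htot x y with h | h
    · rw [rhoStar_eq_one (one_le_rres_iff.2 (sup_le h le_rfl))]
      exact sup_eq_right.2 (lamStar_le_one _ _)
    · rw [lamStar_eq_one (one_le_rres_iff.2 (sup_le le_rfl h))]
      exact sup_eq_left.2 (rhoStar_le_one _ _)

theorem isSemilinear_of_starQuasiIdentity (hV : V.StarQuasiIdentity)
    (htot : ∀ (L : Type u) [ResiduatedLattice L], V.Mem L →
      (∀ a b : L, a ⊔ b = 1 → a = 1 ∨ b = 1) → IsTotallyOrdered L) : V.IsSemilinear := by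
  intro W hW L _ hL
  -- One chain quotient for each failing inequality; together they separate points.
  have key : ∀ p : {p : L × L // ¬p.1 ≤ p.2}, ∃ (F : Set L) (hF : IsNormalFilter F),
      ¬hF.le p.1.1 p.1.2 ∧ W.Mem hF.Quot := by
    rintro ⟨⟨a, b⟩, hab⟩
    have hc : (a ⟍ b) ⊓ 1 ≠ 1 := fun h => hab (one_le_lres_iff.1 (inf_eq_right.1 h))
    obtain ⟨F, hmax⟩ := exists_maximal_isNormalFilter_notMem hc
    have hF := hmax.1.1
    have hQ : V.Mem hF.Quot :=
      V.mem_of_surjective L _ hF.toQuot hF.isHom_toQuot hF.toQuot_surjective hL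
    exact ⟨F, hF, fun h => hmax.1.2 (hF.le_iff_mem.1 h),
      hW _ hQ (htot _ hQ fun _ _ =>
        eq_one_or_eq_one_of_sup_eq_one hF hmax inf_le_right (hV _ hQ))⟩
  choose F hF hle hmem using key
  refine W.mem_of_injective L (∀ p, (hF p).Quot) (fun x p => (hF p).toQuot x)
    (.pi fun p => (hF p).isHom_toQuot) (fun a b hab => ?_) (W.mem_pi _ _ hmem)
  have aux : ∀ a b : L, (∀ p, (hF p).toQuot a = (hF p).toQuot b) → a ≤ b := fun a b h => by
    by_contra hn
    exact hle ⟨(a, b), hn⟩ ((hF _).toQuot_le_toQuot.1 (h _).le)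
  exact le_antisymm (aux a b (congrFun hab)) (aux b a fun p => (congrFun hab p).symm)

theorem LeftPrelinear.isSemilinear (hV : V.LeftPrelinear) (hq : V.StarQuasiIdentity) :
    V.IsSemilinear :=
  isSemilinear_of_starQuasiIdentity hq fun L _ hL hprime x y =>
    (hprime _ _ (hV L hL x y)).imp (fun h => one_le_lres_iff.1 (inf_eq_right.1 h))
      fun h => one_le_lres_iff.1 (inf_eq_right.1 h)

theorem RightPrelinear.isSemilinear (hV : V.RightPrelinear) (hq : V.StarQuasiIdentity) :
    V.IsSemilinear :=
  isSemilinear_of_starQuasiIdentity hq fun L _ hL hprime x y =>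
    (hprime _ _ (hV L hL x y)).imp (fun h => one_le_rres_iff.1 (inf_eq_right.1 h))
      fun h => one_le_rres_iff.1 (inf_eq_right.1 h)

theorem leftPrelinear_and_starQuasiIdentity
    (hV : ∀ (L : Type u) [ResiduatedLattice L], V.Mem L → ∀ x y u v : L,
      lamStar u ((x ⊔ y) ⟍ x) ⊔ rhoStar v ((x ⊔ y) ⟍ y) = 1) :
    V.LeftPrelinear ∧ V.StarQuasiIdentity := by
  constructor
  · intro L _ hL x y
    refine le_antisymm (sup_le inf_le_right inf_le_right) ?_
    -- The conjugators left open are unified with the conjugated residuals themselves.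
    refine (hV L hL y x _ _).ge.trans (sup_le_sup
      (le_inf ((lamStar_self_le _).trans (lres_anti_left le_sup_right y)) (lamStar_le_one _ _))
      (le_inf ((rhoStar_self_le _).trans (lres_anti_left le_sup_left x)) (rhoStar_le_one _ _)))
  · intro L _ hL x y u v hxy
    simpa only [hxy, one_lres] using hV L hL x y u v

theorem rightPrelinear_and_starQuasiIdentity
    (hV : ∀ (L : Type u) [ResiduatedLattice L], V.Mem L → ∀ x y u v : L,
      lamStar u (x ⟋ (x ⊔ y)) ⊔ rhoStar v (y ⟋ (x ⊔ y)) = 1) :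
    V.RightPrelinear ∧ V.StarQuasiIdentity := by
  constructor
  · intro L _ hL x y
    refine le_antisymm (sup_le inf_le_right inf_le_right) ?_
    refine (hV L hL y x _ _).ge.trans (sup_le_sup
      (le_inf ((lamStar_self_le _).trans (rres_anti_right le_sup_right y)) (lamStar_le_one _ _))
      (le_inf ((rhoStar_self_le _).trans (rres_anti_right le_sup_left x)) (rhoStar_le_one _ _)))
  · intro L _ hL x y u v hxy
    simpa only [hxy, rres_one] using hV L hL x y u v

end Variety

end ResiduatedLattice

theorem theorem5p9 (V : ResiduatedLattice.Variety.{u}) :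
    List.TFAE [
      V.IsSemilinear,
      ∀ (L : Type u) [ResiduatedLattice L], V.Mem L → ∀ x y u v : L,
        ResiduatedLattice.lamStar u ((x ⊔ y) ⟍ x) ⊔
          ResiduatedLattice.rhoStar v ((x ⊔ y) ⟍ y) = 1,
      ∀ (L : Type u) [ResiduatedLattice L], V.Mem L → ∀ x y u v : L,
        ResiduatedLattice.lamStar u (x ⟋ (x ⊔ y)) ⊔
          ResiduatedLattice.rhoStar v (y ⟋ (x ⊔ y)) = 1,
      V.LeftPrelinear ∧ V.StarQuasiIdentity,
      V.RightPrelinear ∧ V.StarQuasiIdentity] := by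
  tfae_have 1 → 2 := fun h => h.lres_equation
  tfae_have 1 → 3 := fun h => h.rres_equation
  tfae_have 2 → 4 := ResiduatedLattice.Variety.leftPrelinear_and_starQuasiIdentity
  tfae_have 3 → 5 := ResiduatedLattice.Variety.rightPrelinear_and_starQuasiIdentity
  tfae_have 4 → 1 := fun h => h.1.isSemilinear h.2
  tfae_have 5 → 1 := fun h => h.1.isSemilinear h.2
  tfae_finish
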